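/- Consider forests on the vertex set $\{1,\dots,n\}$. For two graphs $G,H$ with $n$ vertices let $$d(G,H)=\min_{\pi}\bigl(\#\{\{u,v\}\in E(G) : \{\pi(u),\pi(v)\}\notin E(H)\}+\#\{\{u,v\}\notin E(G) : \{\pi(u),\pi(v)\}\in E(H)\}\bigr),$$ where $\pi$ ranges over the bijections $V(G)\to V(H)$; $G$ is $\varepsilon$-far from isomorphic to $H$ if $d(G,H)\ge\varepsilon n$. In the adjacency list model an algorithm knows $n$ and accesses its input graph $G$ only through an oracle that fixes an (arbitrary) ordering of the neighbors of each vertex and answers degree queries (given $v$, return $\deg_G(v)$) and neighbor queries (given $v$ and $i$, return the $i$-th neighbor of $v$, or a special symbol if $\deg_G(v)<i$). For a fixed forest $H$ with $n$ vertices, an $\varepsilon$-tester for isomorphism to $H$ is a randomized adaptive algorithm that, given oracle access to any forest $G$ with $n$ vertices (with any ordering of the neighbors), accepts with probability at least $2/3$ if $G$ is isomorphic to $H$ and rejects with probability at least $2/3$ if $G$ is $\varepsilon$-far from isomorphic to $H$. **Theorem.** In the adjacency list model, testing forest-isomorphism requires $\Omega(\sqrt{\log n})$ queries. That is, there are absolute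 constants $\varepsilon_0>0$, $c>0$ and $n_0$ such that for every $n\ge n_0$ there is a forest $H$ with $n$ vertices such that for every $0<\varepsilon\le\varepsilon_0$ and every $q$, every $\varepsilon$-tester for isomorphism to $H$ that makes at most $q$ queries on every input forest with $n$ vertices satisfies $q\ge c\sqrt{\log n}$. -/

import Mathlib

/-- The distance `d(G, H)` between two graphs with the same number `n` of vertices: the minimum,
over all bijections `π` of the vertices, of the number of (unordered) edges of `G` that `π` does not
send to edges of `H` plus the number of non-edges of `G` that `π` sends to edges of `H`. -/
noncomputable def graphDist {n : ℕ} (G H : SimpleGraph (Fin n)) : ℕ :=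
  ⨅ π : Equiv.Perm (Fin n),
    ({e : Sym2 (Fin n) | e ∈ G.edgeSet ∧ e.map π ∉ H.edgeSet}.ncard +
      {e : Sym2 (Fin n) | e ∉ G.edgeSet ∧ e.map π ∈ H.edgeSet}.ncard)

/-- `G` is `ε`-far from being isomorphic to `H`: at least `ε n` edges have to be added or removed
to make `G` isomorphic to `H`. -/
def IsFarFromIso {n : ℕ} (ε : ℝ) (G H : SimpleGraph (Fin n)) : Prop :=
  ε * (n : ℝ) ≤ (graphDist G H : ℝ)

/-- An adjacency list representation of `G`: every vertex comes with a list, in an arbitrary order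
and without repetitions, of its neighbors. -/
structure AdjList {n : ℕ} (G : SimpleGraph (Fin n)) where
  nbrs : Fin n → List (Fin n)
  nodup : ∀ v, (nbrs v).Nodup
  mem_iff : ∀ v w, w ∈ nbrs v ↔ G.Adj v w

/-- A deterministic adaptive algorithm with oracle access, in the adjacency list model, to a graph
on the vertex set `Fin n`. It either stops and outputs a Boolean (`true` = accept), or asks for the
degree of a vertex `v`, or asks for the `i`-th neighbor of a vertex `v` (counted from `0`), and
continues depending on the answer. -/
inductive QueryAlg (n : ℕ) : Type
  | output (b : Bool) : QueryAlg n
  | degreeQuery (v : Fin n) (next : ℕ → QueryAlg n) : QueryAlg n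
  | neighborQuery (v : Fin n) (i : ℕ) (next : Option (Fin n) → QueryAlg n) : QueryAlg n

namespace QueryAlg

/-- The output on the oracle given by the adjacency lists `L`. The answer to a degree query is the
length of the list of `v`; the answer to a neighbor query is the `i`-th entry of the list of `v`,
or `none` if there is no such entry. -/
def run {n : ℕ} {G : SimpleGraph (Fin n)} (L : AdjList G) : QueryAlg n → Bool
  | output b => b
  | degreeQuery v next => run L (next (L.nbrs v).length)
  | neighborQuery v i next => run L (next (L.nbrs v)[i]?)

/-- The number of queries made on the oracle given by the adjacency lists `L`. -/
def numQueries {n : ℕ} {G : SimpleGraph (Fin n)} (L : AdjList G) : QueryAlg n → ℕ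
  | output _ => 0
  | degreeQuery v next => numQueries L (next (L.nbrs v).length) + 1
  | neighborQuery v i next => numQueries L (next (L.nbrs v)[i]?) + 1

end QueryAlg

/-- A randomized algorithm, given as a random deterministic algorithm `A ω` with `ω` drawn from the
probability space `(Ω, P)`, is an `ε`-tester for being isomorphic to `H`, the input being a forest
`G` with the same number of vertices: whatever the adjacency lists of `G` are, it accepts with
probability at least `2/3` if `G` is isomorphic to `H`, and rejects with probability at least `2/3`
if `G` is `ε`-far from being isomorphic to `H`. -/
structure IsForestIsoTester {n : ℕ} {Ω : Type*} [MeasurableSpace Ω] (P : MeasureTheory.Measure Ω)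
    (A : Ω → QueryAlg n) (ε : ℝ) (H : SimpleGraph (Fin n)) : Prop where
  measurable_accept : ∀ G : SimpleGraph (Fin n), G.IsAcyclic → ∀ L : AdjList G,
    MeasurableSet {ω | (A ω).run L = true}
  accepts : ∀ G : SimpleGraph (Fin n), G.IsAcyclic → ∀ L : AdjList G,
    Nonempty (G ≃g H) → 2 / 3 ≤ P.real {ω | (A ω).run L = true}
  rejects : ∀ G : SimpleGraph (Fin n), G.IsAcyclic → ∀ L : AdjList G,
    IsFarFromIso ε G H → 2 / 3 ≤ P.real {ω | (A ω).run L = false}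

/-- On every input forest, for every choice of its adjacency lists and every outcome of the random
choices, the algorithm makes at most `q` queries. -/
def MakesAtMostQueries {n : ℕ} {Ω : Type*} (A : Ω → QueryAlg n) (q : ℕ) : Prop :=
  ∀ G : SimpleGraph (Fin n), G.IsAcyclic → ∀ (L : AdjList G) (ω : Ω), (A ω).numQueries L ≤ q

/-! The hard instances are star forests built from `p` pairs of blocks, each block having `2 ^ k`
vertices and being filled with equal stars. Pair `j` uses the star sizes `2 ^ (2j+2)` and `2 ^
(2j+3)`. In a mixed filling its two blocks use different sizes; in a pure filling they use the same
one. All mixed fillings are isomorphic, and `H` is one of them. A pure filling lacks a size of `H`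
in every pair. Star sizes are powers of two, so every missing center costs a constant fraction of
its star, and the distance is linear in `n` (`mul_two_pow_le_graphDist`).

Only an algorithm that reaches both blocks of some pair can tell the two kinds apart: otherwise
flipping bits injectively turns a mixed filling into a pure one with the same run
(`card_accepts_and_not_collides_le`). Under a random labelling, `q` queries reach both blocks of a
pair with probability at most `q ^ 2 * 2 ^ k / (n - 2 * q)`, which is at most `q ^ 2 / p` when `n ≥
2 * p * 2 ^ k` and `4 * q ≤ n` (`card_collides_le`). Averaging over labellings, bits and the
randomness of the tester gives `2/3 ≤ 1/3 + q ^ 2 / p`, that is `p ≤ 3 * q ^ 2`. Doubling star sizes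
leave room for `p` of order `log n`. -/

/-! ### Lower bounds on the distance from degrees. -/

section Distance

open Finset Classical in
theorem sum_ncard_neighborSet {V : Type*} [Fintype V] (G : SimpleGraph V) :
    ∑ v, (G.neighborSet v).ncard = 2 * G.edgeSet.ncard := by
  rw [← SimpleGraph.coe_edgeFinset, Set.ncard_coe_finset, ← G.sum_degrees_eq_twice_card_edges]
  refine Finset.sum_congr rfl fun v _ => ?_
  rw [← Nat.card_coe_set_eq, Nat.card_eq_fintype_card, SimpleGraph.card_neighborSet_eq_degree]

theorem ncard_neighborSet_comap {V W : Type*} (G : SimpleGraph W) (e : V ≃ W) (v : V) :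
    ((G.comap e).neighborSet v).ncard = (G.neighborSet (e v)).ncard :=
  Set.ncard_preimage_of_injective_subset_range e.injective fun w _ => e.surjective w

theorem ncard_neighborSet_le_add {V : Type*} [Finite V] (G K : SimpleGraph V) (v : V) :
    (G.neighborSet v).ncard ≤ (K.neighborSet v).ncard + ((G \ K).neighborSet v).ncard := by
  refine (Set.ncard_le_ncard (fun w hw => ?_) (Set.toFinite _)).trans (Set.ncard_union_le _ _)
  simp only [SimpleGraph.mem_neighborSet, Set.mem_union, SimpleGraph.sdiff_adj] at hw ⊢
  tauto

/-- A bijection of the vertices changes the degrees by at most twice its cost in total. -/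
theorem sum_dist_ncard_neighborSet_le {n : ℕ} (G H : SimpleGraph (Fin n))
    (π : Equiv.Perm (Fin n)) :
    ∑ v, Nat.dist (G.neighborSet v).ncard (H.neighborSet (π v)).ncard ≤
      2 * ({e : Sym2 (Fin n) | e ∈ G.edgeSet ∧ e.map π ∉ H.edgeSet}.ncard +
        {e : Sym2 (Fin n) | e ∉ G.edgeSet ∧ e.map π ∈ H.edgeSet}.ncard) := by
  have h1 : {e : Sym2 (Fin n) | e ∈ G.edgeSet ∧ e.map π ∉ H.edgeSet} =
      (G \ H.comap π).edgeSet := by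
    ext e
    induction e with | _ x y => simp
  have h2 : {e : Sym2 (Fin n) | e ∉ G.edgeSet ∧ e.map π ∈ H.edgeSet} =
      (H.comap π \ G).edgeSet := by
    ext e
    induction e with | _ x y => simp; tauto
  rw [h1, h2, mul_add, ← sum_ncard_neighborSet, ← sum_ncard_neighborSet,
    ← Finset.sum_add_distrib]
  refine Finset.sum_le_sum fun v _ => ?_
  rw [← ncard_neighborSet_comap]
  have h3 := ncard_neighborSet_le_add G (H.comap π) v
  have h4 := ncard_neighborSet_le_add (H.comap π) G v
  unfold Nat.dist
  omega

/-- If every vertex of `M` has in `H` a degree far from all degrees of `G`, then `G` is far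
from `H`. -/
theorem sum_le_graphDist {n : ℕ} (G H : SimpleGraph (Fin n)) (M : Finset (Fin n))
    (h : ∀ y ∈ M, ∀ v, (H.neighborSet y).ncard + 1 ≤
      2 * Nat.dist (G.neighborSet v).ncard (H.neighborSet y).ncard) :
    ∑ y ∈ M, ((H.neighborSet y).ncard + 1) ≤ 4 * graphDist G H := by
  obtain ⟨π, hπ⟩ := Nat.sInf_mem (Set.range_nonempty fun π : Equiv.Perm (Fin n) =>
    ({e : Sym2 (Fin n) | e ∈ G.edgeSet ∧ e.map π ∉ H.edgeSet}.ncard +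
      {e : Sym2 (Fin n) | e ∉ G.edgeSet ∧ e.map π ∈ H.edgeSet}.ncard))
  have hd := sum_dist_ncard_neighborSet_le G H π
  have hπ' : ({e : Sym2 (Fin n) | e ∈ G.edgeSet ∧ e.map π ∉ H.edgeSet}.ncard +
      {e : Sym2 (Fin n) | e ∉ G.edgeSet ∧ e.map π ∈ H.edgeSet}.ncard) = graphDist G H := hπ
  rw [hπ'] at hd
  -- One factor 2 comes from the hypothesis, the other from each edge having two ends; hence the 4.
  have h1 : ∑ y ∈ M, ((H.neighborSet y).ncard + 1) ≤
      ∑ y, 2 * Nat.dist (G.neighborSet (π.symm y)).ncard (H.neighborSet y).ncard :=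
    (Finset.sum_le_sum fun y hy => h y hy (π.symm y)).trans
      (Finset.sum_le_sum_of_subset (Finset.subset_univ M))
  have h2 : ∑ y, Nat.dist (G.neighborSet (π.symm y)).ncard (H.neighborSet y).ncard =
      ∑ v, Nat.dist (G.neighborSet v).ncard (H.neighborSet (π v)).ncard := by
    rw [← Equiv.sum_comp π]
    simp
  rw [← Finset.mul_sum, h2] at h1
  omega

end Distance

/-! ### Disjoint unions of stars. -/

section StarForest

variable {V : Type*}

/-- The graph in which every vertex `v` is joined to `c v`; for an idempotent `c` it is a disjoint
union of stars centered at the fixed points of `c`. -/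
def starForest (c : V → V) : SimpleGraph V where
  Adj v w := v ≠ w ∧ (c v = w ∨ c w = v)
  symm := ⟨fun _ _ h => ⟨h.1.symm, h.2.symm⟩⟩
  loopless := ⟨fun _ h => h.1 rfl⟩

theorem starForest_adj {c : V → V} {v w : V} :
    (starForest c).Adj v w ↔ v ≠ w ∧ (c v = w ∨ c w = v) := Iff.rfl

theorem starForest_adj_of_ne {c : V → V} (hc : ∀ v, c (c v) = c v) {v w : V} (hv : c v ≠ v) :
    (starForest c).Adj v w ↔ w = c v := by
  rw [starForest_adj]
  constructor
  · rintro ⟨_, rfl | rfl⟩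
    · rfl
    · exact absurd (hc w) hv
  · rintro rfl
    exact ⟨hv.symm, Or.inl rfl⟩

/-- Every edge is a bridge: one of its ends is a leaf, which becomes isolated when the edge is
deleted. -/
theorem starForest_isAcyclic {c : V → V} (hc : ∀ v, c (c v) = c v) :
    (starForest c).IsAcyclic := by
  refine SimpleGraph.isAcyclic_iff_forall_adj_isBridge.mpr fun v w hadj => ?_
  wlog h : c v = w generalizing v w
  · rw [Sym2.eq_swap]
    exact this w v hadj.symm ((starForest_adj.1 hadj).2.resolve_left h)
  subst h
  have hv : c v ≠ v := hadj.ne.symm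
  rw [SimpleGraph.isBridge_iff]
  rintro ⟨p⟩
  generalize hw : c v = w at p
  cases p with
  | nil => exact hv hw
  | cons h p =>
    rw [SimpleGraph.deleteEdges_adj, starForest_adj_of_ne hc hv] at h
    exact h.2 (by rw [h.1, hw]; rfl)

theorem ncard_neighborSet_starForest_of_ne {c : V → V} (hc : ∀ v, c (c v) = c v) {v : V}
    (hv : c v ≠ v) : ((starForest c).neighborSet v).ncard = 1 := by
  rw [Set.ncard_eq_one]
  refine ⟨c v, ?_⟩
  ext w
  exact starForest_adj_of_ne hc hv

theorem ncard_neighborSet_starForest_of_eq [Finite V] {c : V → V} {v : V}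
    (hv : c v = v) : ((starForest c).neighborSet v).ncard + 1 = {w | c w = v}.ncard := by
  have : {w | c w = v} = insert v ((starForest c).neighborSet v) := by
    ext w
    simp only [Set.mem_ofPred_eq, Set.mem_insert_iff, SimpleGraph.mem_neighborSet,
      starForest_adj, hv]
    by_cases hw : w = v
    · simp [hw, hv]
    · simp [hw, Ne.symm hw]
  rw [this, Set.ncard_insert_of_notMem (by simp) (Set.toFinite _)]

end StarForest

/-! ### The block forests, mixed and pure. -/

section Construction

variable {p k r : ℕ}

/-- The vertices: for each of `2 * p` blocks `2 ^ k` vertices, and `r` isolated vertices. -/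
abbrev BlockVertex (p k r : ℕ) : Type := (Fin p × Bool) × Fin (2 ^ k) ⊕ Fin r

/-- The block of a vertex. -/
def block : BlockVertex p k r → Option (Fin p × Bool) :=
  Sum.elim (fun x => some x.1) fun _ => none

/-- The stars of the block `B` have `2 ^ blockExp f B` vertices. -/
def blockExp (f : Fin p × Bool → Bool) (B : Fin p × Bool) : ℕ := 2 * B.1 + (f B).toNat + 2

/-- The center of the star of a vertex. -/
def center (f : Fin p × Bool → Bool) : BlockVertex p k r → BlockVertex p k r
  | Sum.inl (B, x) =>
    Sum.inl (B, ⟨x / 2 ^ blockExp f B * 2 ^ blockExp f B, (Nat.div_mul_le_self _ _).trans_lt x.2⟩)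
  | Sum.inr i => Sum.inr i

@[simp]
theorem center_inl (f : Fin p × Bool → Bool) (B : Fin p × Bool) (x : Fin (2 ^ k)) :
    center (r := r) f (Sum.inl (B, x)) = Sum.inl (B, ⟨x / 2 ^ blockExp f B * 2 ^ blockExp f B,
      (Nat.div_mul_le_self _ _).trans_lt x.2⟩) := rfl

@[simp]
theorem center_inr (f : Fin p × Bool → Bool) (i : Fin r) :
    center (k := k) f (Sum.inr i) = Sum.inr i := rfl

theorem center_center (f : Fin p × Bool → Bool) (v : BlockVertex p k r) :
    center f (center f v) = center f v := by
  rcases v with ⟨B, x⟩ | i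
  · simp [center]
  · rfl

theorem block_center (f : Fin p × Bool → Bool) (v : BlockVertex p k r) :
    block (center f v) = block v := by
  rcases v with ⟨B, x⟩ | i <;> rfl

theorem center_congr {f g : Fin p × Bool → Bool} {v : BlockVertex p k r}
    (h : ∀ B, block v = some B → f B = g B) : center f v = center g v := by
  rcases v with ⟨B, x⟩ | i
  · have : f B = g B := h B rfl
    simp [center, blockExp, this]
  · rfl

/-- The forest in which the block `B` is filled with stars with `2 ^ blockExp f B` vertices. -/
abbrev blockForest (k r : ℕ) (f : Fin p × Bool → Bool) : SimpleGraph (BlockVertex p k r) :=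
  starForest (center f)

theorem block_eq_of_adj {f : Fin p × Bool → Bool} {v w : BlockVertex p k r}
    (h : (blockForest k r f).Adj v w) : block w = block v := by
  rcases (starForest_adj.1 h).2 with rfl | rfl
  · exact block_center f v
  · exact (block_center f w).symm

/-- Stars stay inside their blocks, so the neighborhood of a vertex depends only on the bit of its
own block. -/
theorem blockForest_adj_congr {f g : Fin p × Bool → Bool} {v w : BlockVertex p k r}
    (h : ∀ B, block v = some B → f B = g B) :
    (blockForest k r f).Adj v w ↔ (blockForest k r g).Adj v w := by
  by_cases hw : block w = block v
  · rw [starForest_adj, starForest_adj, center_congr h, center_congr (v := w) (hw ▸ h)]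
  · exact ⟨fun h => absurd (block_eq_of_adj h) hw, fun h => absurd (block_eq_of_adj h) hw⟩

/-- The two blocks of each pair have the two different star sizes, in the order given by `b`. -/
def mixedFilling (b : Fin p → Bool) (B : Fin p × Bool) : Bool := B.2 ^^ b B.1

/-- The two blocks of each pair have the same star size, given by `b`. -/
def pureFilling (b : Fin p → Bool) (B : Fin p × Bool) : Bool := b B.1

/-- All forests with a mixed filling are isomorphic. -/
theorem nonempty_iso_mixedFilling (b b' : Fin p → Bool) :
    Nonempty (blockForest k r (mixedFilling b) ≃g blockForest k r (mixedFilling b')) := by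
  -- The isomorphism exchanges the two blocks of exactly those pairs on which `b` and `b'` differ.
  let s : BlockVertex p k r → BlockVertex p k r :=
    Sum.map (fun x => ((x.1.1, x.1.2 ^^ (b x.1.1 ^^ b' x.1.1)), x.2)) id
  have hs : Function.Involutive s := by
    rintro (⟨⟨j, t⟩, x⟩ | i) <;> simp [s]
  have hc : ∀ v, center (mixedFilling b') (s v) = s (center (mixedFilling b) v) := by
    rintro (⟨⟨j, t⟩, x⟩ | i)
    · have : (t ^^ (b j ^^ b' j) ^^ b' j) = (t ^^ b j) := by
        cases t <;> cases b j <;> cases b' j <;> rfl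
      simp [s, center, blockExp, mixedFilling, this]
    · rfl
  refine ⟨⟨hs.toPerm, fun {v w} => ?_⟩⟩
  change (starForest _).Adj (s v) (s w) ↔ _
  simp only [starForest_adj, hc, hs.injective.eq_iff, ne_eq]

/-- The star size divides `2 ^ k`, so the block splits into intervals of full length and no star is
truncated. -/
theorem ncard_center_eq {f : Fin p × Bool → Bool} {B : Fin p × Bool}
    (hk : blockExp f B ≤ k) {v : BlockVertex p k r} (hB : block v = some B)
    (hv : center f v = v) : {w | center f w = v}.ncard = 2 ^ blockExp f B := by
  rcases v with ⟨B', x⟩ | i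
  swap
  · simp [block] at hB
  obtain rfl : B' = B := by simpa [block] using hB
  set d := 2 ^ blockExp f B' with hd
  have hd0 : 0 < d := by positivity
  have hx : (x : ℕ) / d * d = x := by
    have := congrArg (Sum.elim (fun y => (y.2 : ℕ)) fun _ => 0) hv
    simpa [center] using this
  obtain ⟨e, he⟩ : d ∣ 2 ^ k := pow_dvd_pow 2 hk
  have hlt : ∀ t, t < d → (x : ℕ) + t < 2 ^ k := by
    intro t ht
    have h1 : (x : ℕ) / d < e := Nat.div_lt_of_lt_mul (he ▸ x.2)
    have h2 : ((x : ℕ) / d + 1) * d ≤ e * d := Nat.mul_le_mul_right d h1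
    rw [mul_comm e d, ← he, add_mul, hx] at h2
    omega
  have hinj : Function.Injective fun t : Fin d =>
      (Sum.inl (B', ⟨x + t, hlt t t.2⟩) : BlockVertex p k r) := by
    intro s t h
    simpa [Fin.ext_iff] using h
  rw [← Nat.card_fin d, ← Set.ncard_range_of_injective hinj]
  congr 1
  ext w
  simp only [Set.mem_ofPred_eq, Set.mem_range]
  constructor
  · rcases w with ⟨B'', y⟩ | i
    · intro hy
      simp only [center_inl, Sum.inl.injEq, Prod.mk.injEq, Fin.ext_iff] at hy
      obtain ⟨rfl, hy⟩ := hy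
      rw [← hd] at hy
      refine ⟨⟨y % d, Nat.mod_lt _ hd0⟩, ?_⟩
      have := Nat.div_add_mod' (y : ℕ) d
      simp only [Sum.inl.injEq, Prod.mk.injEq, true_and, Fin.ext_iff]
      omega
    · simp
  · rintro ⟨t, rfl⟩
    have : ((x : ℕ) + t) / d = x / d := by
      rw [← hx, Nat.add_comm, Nat.add_mul_div_right _ _ hd0, Nat.div_eq_of_lt t.2,
        Nat.mul_div_cancel _ hd0, zero_add]
    simp only [center_inl, ← hd, this, hx]

/-- The degrees of a block forest. -/
theorem exists_ncard_neighborSet_blockForest {f : Fin p × Bool → Bool}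
    (hk : ∀ B, blockExp f B ≤ k) (v : BlockVertex p k r) :
    ∃ e, ((blockForest k r f).neighborSet v).ncard + 1 = 2 ^ e ∧ (e ≤ 1 ∨ ∃ B, e = blockExp f B) := by
  by_cases hv : center f v = v
  · rw [ncard_neighborSet_starForest_of_eq hv]
    rcases v with ⟨B, x⟩ | i
    · exact ⟨_, ncard_center_eq (hk B) rfl hv, Or.inr ⟨B, rfl⟩⟩
    · refine ⟨0, ?_, Or.inl zero_le_one⟩
      rw [pow_zero, Set.ncard_eq_one]
      refine ⟨Sum.inr i, ?_⟩
      ext w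
      rcases w with ⟨B, y⟩ | j <;> simp
  · exact ⟨1, by rw [ncard_neighborSet_starForest_of_ne (center_center f) hv, pow_one], Or.inl le_rfl⟩

theorem two_pow_le_two_mul_dist {a b c d : ℕ} (h : c ≠ d) (ha : a + 1 = 2 ^ c)
    (hb : b + 1 = 2 ^ d) : b + 1 ≤ 2 * Nat.dist a b := by
  have key : ∀ {c d : ℕ}, c < d → 2 * 2 ^ c ≤ 2 ^ d := fun {c d} h => by
    rw [← pow_succ']; exact Nat.pow_le_pow_right two_pos h
  unfold Nat.dist
  rcases lt_or_gt_of_ne h with h | h <;> have := key h <;> omega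

theorem blockExp_le {f : Fin p × Bool → Bool} (hk : 2 * p + 1 ≤ k) (B : Fin p × Bool) :
    blockExp f B ≤ k := by
  have := B.1.2
  have := (f B).toNat_le
  unfold blockExp
  omega

open Finset Classical in
/-- A forest with a pure filling is far from every forest with a mixed filling. -/
theorem mul_two_pow_le_graphDist {n : ℕ} (hk : 2 * p + 1 ≤ k) (σ τ : Fin n ≃ BlockVertex p k r)
    (b b' : Fin p → Bool) :
    p * 2 ^ k ≤ 4 * graphDist ((blockForest k r (pureFilling b)).comap σ)
      ((blockForest k r (mixedFilling b')).comap τ) := by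
  set g := mixedFilling b'
  -- The centers of the mixed forest in those blocks, one per pair, whose star size is `!(b j)`, the
  -- one absent from the pure forest.
  set C : Finset (BlockVertex p k r) :=
    {v | center g v = v ∧ ∃ j, block v = some (j, !(b j ^^ b' j))} with hC
  refine le_trans ?_ (sum_le_graphDist _ _ (C.map τ.symm.toEmbedding) ?_)
  · rw [Finset.sum_map]
    simp only [ncard_neighborSet_comap, Equiv.coe_toEmbedding, Equiv.apply_symm_apply]
    have h1 : ∀ v ∈ C, ((blockForest k r g).neighborSet v).ncard + 1 =
        #{w ∈ (univ.filter fun w : BlockVertex p k r =>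
          ∃ j, block w = some (j, !(b j ^^ b' j))) | center g w = v} := by
      intro v hv
      simp only [hC, Finset.mem_filter, Finset.mem_univ, true_and] at hv
      rw [ncard_neighborSet_starForest_of_eq hv.1, Finset.filter_filter, ← Set.ncard_coe_finset]
      congr 1
      ext w
      simp only [Finset.coe_filter, Finset.mem_univ, true_and, Set.mem_ofPred_eq]
      refine ⟨fun h => ⟨?_, h⟩, fun h => h.2⟩
      rw [← block_center g w, h]
      exact hv.2
    -- The stars around these centers partition the chosen blocks, so the sum of their sizes is the
    -- number `p * 2 ^ k` of vertices there.
    rw [Finset.sum_congr rfl h1, ← Finset.card_eq_sum_card_fiberwise]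
    · have : p * 2 ^ k = (univ : Finset (Fin p × Fin (2 ^ k))).card := by simp
      rw [this]
      refine Finset.card_le_card_of_injOn
        (fun x => Sum.inl ((x.1, !(b x.1 ^^ b' x.1)), x.2)) ?_ ?_
      · intro x _
        simp only [Finset.coe_filter, Finset.mem_univ, true_and, Set.mem_ofPred_eq]
        exact ⟨x.1, rfl⟩
      · intro x _ y _ h
        simp only [Sum.inl.injEq, Prod.mk.injEq] at h
        exact Prod.ext h.1.1 h.2
    · intro w hw
      simp only [hC, Finset.coe_filter, Finset.mem_univ, true_and, Set.mem_ofPred_eq] at hw ⊢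
      exact ⟨center_center g w, by rwa [block_center]⟩
  · intro y hy v
    obtain ⟨c, hc, rfl⟩ := Finset.mem_map.1 hy
    simp only [hC, Finset.mem_filter, Finset.mem_univ, true_and] at hc
    obtain ⟨hc, j, hj⟩ := hc
    simp only [ncard_neighborSet_comap, Equiv.coe_toEmbedding, Equiv.apply_symm_apply]
    obtain ⟨e, he, he'⟩ := exists_ncard_neighborSet_blockForest (f := pureFilling b)
      (blockExp_le hk) (σ v)
    have hcdeg := (ncard_neighborSet_starForest_of_eq hc).trans
      (ncard_center_eq (blockExp_le hk _) hj hc)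
    refine two_pow_le_two_mul_dist ?_ he hcdeg
    rcases he' with he' | ⟨⟨i, t⟩, rfl⟩
    -- Isolated vertices and leaves have exponents 0 and 1; the summand 2 in `blockExp` keeps the
    -- centers clear of both.
    · unfold blockExp; omega
    · simp only [blockExp, pureFilling, g, mixedFilling]
      intro h
      by_cases hij : i = j
      · subst hij
        revert h
        cases b i <;> cases b' i <;> simp
      -- Different pairs use disjoint sets of exponents, `{2i+2, 2i+3}` and `{2j+2, 2j+3}`.
      · apply hij
        rw [Fin.ext_iff]
        have h1 := (b i).toNat_le
        have h2 := (!(b j ^^ b' j) ^^ b' j).toNat_le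
        omega

end Construction

/-! ### Runs of a query algorithm and their dependence on the adjacency lists. -/

section Runs

namespace QueryAlg

variable {n : ℕ}

/-- The remaining algorithm after one query, with the adjacency lists `N`. -/
def step (N : Fin n → List (Fin n)) : QueryAlg n → QueryAlg n
  | output b => output b
  | degreeQuery v next => next (N v).length
  | neighborQuery v i next => next (N v)[i]?

/-- The vertex about which the next query asks. -/
def asked : QueryAlg n → Finset (Fin n)
  | output _ => ∅
  | degreeQuery v _ => {v}
  | neighborQuery v _ _ => {v}

/-- The vertex that the next answer names. -/
def answered (N : Fin n → List (Fin n)) : QueryAlg n → Finset (Fin n)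
  | output _ => ∅
  | degreeQuery _ _ => ∅
  | neighborQuery v i _ => (N v)[i]?.toFinset

/-- The vertices about which the first `t` queries ask. -/
def askedUpTo (N : Fin n → List (Fin n)) (A : QueryAlg n) (t : ℕ) : Finset (Fin n) :=
  (Finset.range t).biUnion fun i => asked ((step N)^[i] A)

/-- The vertices that occur in the first `t` queries and their answers. -/
def seenUpTo (N : Fin n → List (Fin n)) (A : QueryAlg n) (t : ℕ) : Finset (Fin n) :=
  (Finset.range t).biUnion fun i => asked ((step N)^[i] A) ∪ answered N ((step N)^[i] A)

theorem card_asked_le (A : QueryAlg n) : (asked A).card ≤ 1 := by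
  cases A <;> simp [asked]

theorem card_answered_le (N : Fin n → List (Fin n)) (A : QueryAlg n) :
    (answered N A).card ≤ 1 := by
  cases A with
  | output | degreeQuery => simp [answered]
  | neighborQuery v i next =>
    simp only [answered]
    cases (N v)[i]? <;> simp

theorem card_askedUpTo_le (N : Fin n → List (Fin n)) (A : QueryAlg n) (t : ℕ) :
    (askedUpTo N A t).card ≤ t := by
  have := Finset.card_biUnion_le_card_mul (Finset.range t) (fun i => asked ((step N)^[i] A)) 1
    fun i _ => card_asked_le _
  rwa [Finset.card_range, mul_one] at this

theorem card_seenUpTo_le (N : Fin n → List (Fin n)) (A : QueryAlg n) (t : ℕ) :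
    (seenUpTo N A t).card ≤ 2 * t := by
  have := Finset.card_biUnion_le_card_mul (Finset.range t)
    (fun i => asked ((step N)^[i] A) ∪ answered N ((step N)^[i] A)) 2 fun i _ =>
      (Finset.card_union_le _ _).trans
        (Nat.add_le_add (card_asked_le _) (card_answered_le N _))
  rw [Finset.card_range, mul_comm] at this
  exact this

theorem askedUpTo_succ (N : Fin n → List (Fin n)) (A : QueryAlg n) (t : ℕ) :
    askedUpTo N A (t + 1) = asked ((step N)^[t] A) ∪ askedUpTo N A t := by
  simp [askedUpTo, Finset.range_add_one]

theorem seenUpTo_succ (N : Fin n → List (Fin n)) (A : QueryAlg n) (t : ℕ) :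
    seenUpTo N A (t + 1) =
      asked ((step N)^[t] A) ∪ answered N ((step N)^[t] A) ∪ seenUpTo N A t := by
  simp [seenUpTo, Finset.range_add_one]

theorem askedUpTo_subset_seenUpTo (N : Fin n → List (Fin n)) (A : QueryAlg n) (t : ℕ) :
    askedUpTo N A t ⊆ seenUpTo N A t :=
  Finset.biUnion_mono fun _ _ => Finset.subset_union_left

theorem askedUpTo_mono (N : Fin n → List (Fin n)) (A : QueryAlg n) : Monotone (askedUpTo N A) :=
  fun _ _ h => Finset.biUnion_subset_biUnion_of_subset_left _ (Finset.range_mono h)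

/-- A vertex that occurs was either asked about or is a neighbor of such a vertex. -/
theorem exists_of_mem_seenUpTo {N : Fin n → List (Fin n)} {A : QueryAlg n} {t : ℕ} {v : Fin n}
    (h : v ∈ seenUpTo N A t) : ∃ u ∈ askedUpTo N A t, v = u ∨ v ∈ N u := by
  obtain ⟨i, hi, hv⟩ := Finset.mem_biUnion.1 h
  have hsub : asked ((step N)^[i] A) ⊆ askedUpTo N A t :=
    Finset.subset_biUnion_of_mem (fun i => asked ((step N)^[i] A)) hi
  rcases Finset.mem_union.1 hv with hv | hv
  · exact ⟨v, hsub hv, Or.inl rfl⟩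
  · generalize (step N)^[i] A = B at hv hsub
    cases B with
    | output | degreeQuery => simp [answered] at hv
    | neighborQuery u i next =>
      refine ⟨u, hsub (by simp [asked]), Or.inr ?_⟩
      simp only [answered, Option.mem_toFinset, Option.mem_def] at hv
      exact List.mem_of_getElem? hv

theorem run_iterate_step {G : SimpleGraph (Fin n)} (L : AdjList G) (A : QueryAlg n) (t : ℕ) :
    ((step L.nbrs)^[t] A).run L = A.run L := by
  induction t generalizing A with
  | zero => rfl
  | succ t ih =>
    rw [Function.iterate_succ_apply, ih]
    cases A <;> rfl

theorem numQueries_iterate_step {G : SimpleGraph (Fin n)} (L : AdjList G) (A : QueryAlg n)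
    (t : ℕ) : ((step L.nbrs)^[t] A).numQueries L = A.numQueries L - t := by
  induction t generalizing A with
  | zero => rfl
  | succ t ih =>
    rw [Function.iterate_succ_apply, ih]
    cases A <;> simp [step, numQueries]

/-- Since `step` fixes outputs, shorter runs are padded and all runs can be compared at the same
time `q`. -/
theorem exists_iterate_step_eq_output {G : SimpleGraph (Fin n)} {L : AdjList G} {A : QueryAlg n}
    {q : ℕ} (h : A.numQueries L ≤ q) : (step L.nbrs)^[q] A = output (A.run L) := by
  have h0 := numQueries_iterate_step L A q
  have h1 := run_iterate_step L A q
  rw [Nat.sub_eq_zero_of_le h] at h0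
  generalize (step L.nbrs)^[q] A = B at h0 h1
  cases B with
  | output b => rw [← h1]; rfl
  | degreeQuery | neighborQuery => simp [numQueries] at h0

/-- Two adjacency lists that agree on all vertices asked about lead to the same run. -/
theorem iterate_step_congr {N N' : Fin n → List (Fin n)} {A : QueryAlg n} {t : ℕ}
    (h : ∀ v ∈ askedUpTo N A t, N' v = N v) :
    (step N')^[t] A = (step N)^[t] A ∧ askedUpTo N' A t = askedUpTo N A t := by
  induction t with
  | zero => simp [askedUpTo]
  | succ t ih =>
    obtain ⟨h1, h2⟩ := ih fun v hv => h v (askedUpTo_mono N A t.le_succ hv)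
    rw [askedUpTo_succ, askedUpTo_succ, h1, h2, Function.iterate_succ_apply',
      Function.iterate_succ_apply', h1]
    refine ⟨?_, rfl⟩
    rw [askedUpTo_succ] at h
    generalize (step N)^[t] A = B at h
    cases B with
    | output b => rfl
    | degreeQuery v next | neighborQuery v i next =>
      have := h v (by simp [asked])
      simp only [step, this]

/-- Exchanging the names of two vertices that have not occurred does not change the run. -/
theorem iterate_step_swap {N N' : Fin n → List (Fin n)} {A : QueryAlg n} {t : ℕ} {v w : Fin n}
    (hN : ∀ x, N' x = (N (Equiv.swap v w x)).map (Equiv.swap v w))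
    (hv : v ∉ seenUpTo N A t) (hw : w ∉ seenUpTo N A t) :
    (step N')^[t] A = (step N)^[t] A ∧ askedUpTo N' A t = askedUpTo N A t ∧
      seenUpTo N' A t = seenUpTo N A t := by
  induction t with
  | zero => simp [askedUpTo, seenUpTo]
  | succ t ih =>
    rw [seenUpTo_succ, Finset.notMem_union] at hv hw
    obtain ⟨h1, h2, h3⟩ := ih hv.2 hw.2
    rw [askedUpTo_succ, askedUpTo_succ, seenUpTo_succ, seenUpTo_succ, h1, h2, h3,
      Function.iterate_succ_apply', Function.iterate_succ_apply', h1]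
    replace hv := hv.1
    replace hw := hw.1
    generalize (step N)^[t] A = B at hv hw
    cases B with
    | output b => exact ⟨rfl, rfl, rfl⟩
    | degreeQuery u next =>
      have hu : N' u = (N u).map (Equiv.swap v w) := by
        rw [hN, Equiv.swap_apply_of_ne_of_ne] <;> rintro rfl <;> simp_all [asked]
      simp [step, answered, hu]
    | neighborQuery u i next =>
      have hu : (N' u)[i]? = (N u)[i]? := by
        rw [hN, Equiv.swap_apply_of_ne_of_ne]
        · rw [List.getElem?_map]
          cases hx : (N u)[i]? with
          | none => rfl
          | some x =>
            rw [Option.map_some, Equiv.swap_apply_of_ne_of_ne] <;> rintro rfl <;>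
              simp_all [answered]
        all_goals rintro rfl; simp_all [asked]
      simp [step, answered, hu]

end QueryAlg

end Runs

/-! ### Random labellings and the probability of a collision. -/

section Labelled

variable {n p k r : ℕ}

/-- The adjacency lists of the block forest whose vertex `σ v` is called `v`. -/
noncomputable def labelledNbrs (f : Fin p × Bool → Bool) (σ : Fin n ≃ BlockVertex p k r)
    (v : Fin n) : List (Fin n) :=
  ((blockForest k r f).neighborSet (σ v)).toFinite.toFinset.toList.map σ.symm

/-- The block forest whose vertex `σ v` is called `v`. -/
abbrev labelledForest (f : Fin p × Bool → Bool) (σ : Fin n ≃ BlockVertex p k r) :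
    SimpleGraph (Fin n) :=
  (blockForest k r f).comap σ

theorem mem_labelledNbrs (f : Fin p × Bool → Bool) (σ : Fin n ≃ BlockVertex p k r)
    (v w : Fin n) : w ∈ labelledNbrs f σ v ↔ (labelledForest f σ).Adj v w := by
  simp [labelledNbrs, Equiv.symm_apply_eq]

noncomputable def labelledAdjList (f : Fin p × Bool → Bool) (σ : Fin n ≃ BlockVertex p k r) :
    AdjList (labelledForest f σ) where
  nbrs := labelledNbrs f σ
  nodup _ := (Finset.nodup_toList _).map σ.symm.injective
  mem_iff := mem_labelledNbrs f σ

theorem labelledForest_isAcyclic (f : Fin p × Bool → Bool) (σ : Fin n ≃ BlockVertex p k r) :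
    (labelledForest f σ).IsAcyclic :=
  (SimpleGraph.Iso.comap σ _).isAcyclic_iff.2 (starForest_isAcyclic (center_center f))

theorem labelledNbrs_congr {f g : Fin p × Bool → Bool} {σ : Fin n ≃ BlockVertex p k r}
    {v : Fin n} (h : ∀ B, block (σ v) = some B → f B = g B) :
    labelledNbrs f σ v = labelledNbrs g σ v := by
  have : (blockForest k r f).neighborSet (σ v) = (blockForest k r g).neighborSet (σ v) :=
    Set.ext fun _ => blockForest_adj_congr h
  simp only [labelledNbrs, this]

/-- The order of each list is chosen on the unlabelled forest, so relabelling only renames the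
entries. -/
theorem labelledNbrs_swap (f : Fin p × Bool → Bool) (σ : Fin n ≃ BlockVertex p k r)
    (v w x : Fin n) :
    labelledNbrs f ((Equiv.swap v w).trans σ) x =
      (labelledNbrs f σ (Equiv.swap v w x)).map (Equiv.swap v w) := by
  simp [labelledNbrs]

theorem block_eq_of_mem_labelledNbrs {f : Fin p × Bool → Bool} {σ : Fin n ≃ BlockVertex p k r}
    {v w : Fin n} (h : w ∈ labelledNbrs f σ v) : block (σ w) = block (σ v) :=
  block_eq_of_adj ((mem_labelledNbrs f σ v w).1 h)

/-- The two vertices lie in the two blocks of one pair. -/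
def Partner (v w : BlockVertex p k r) : Prop :=
  ∃ j s, block v = some (j, s) ∧ block w = some (j, !s)

theorem Partner.symm {v w : BlockVertex p k r} : Partner v w → Partner w v := by
  rintro ⟨j, s, hv, hw⟩
  exact ⟨j, !s, hw, by simpa using hv⟩

theorem Partner.irrefl (v : BlockVertex p k r) : ¬ Partner v v := by
  rintro ⟨j, s, hv, hw⟩
  rw [hv] at hw
  simp at hw

theorem Partner.congr_right {v w w' : BlockVertex p k r} (h : Partner v w)
    (hw : block w = block w') : Partner v w' := by
  obtain ⟨j, s, h1, h2⟩ := h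
  exact ⟨j, s, h1, hw ▸ h2⟩

open Finset Classical in
theorem card_filter_partner_le (σ : Fin n ≃ BlockVertex p k r) (v : BlockVertex p k r) :
    #{w | Partner v (σ w)} ≤ 2 ^ k := by
  rw [← Fintype.card_fin (2 ^ k), ← Finset.card_univ]
  by_cases hv : ∃ j s, block v = some (j, s)
  swap
  · rw [Finset.card_eq_zero.2]
    · exact Nat.zero_le _
    · refine Finset.filter_false_of_mem fun w _ hw => hv ?_
      obtain ⟨j, s, h, _⟩ := hw
      exact ⟨j, s, h⟩
  obtain ⟨j, s, hv⟩ := hv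
  have : ({w | Partner v (σ w)} : Finset (Fin n)) ⊆
      univ.image fun x : Fin (2 ^ k) => σ.symm (Sum.inl ((j, !s), x)) := by
    intro w hw
    obtain ⟨j', s', h1, h2⟩ := (Finset.mem_filter.1 hw).2
    rw [hv] at h1
    obtain ⟨rfl, rfl⟩ : j = j' ∧ s = s' := by simpa using h1
    rcases hx : σ w with ⟨B, x⟩ | i
    · rw [hx] at h2
      obtain rfl : B = (j, !s) := by simpa [block] using h2
      exact Finset.mem_image.2 ⟨x, Finset.mem_univ _, by rw [← hx, Equiv.symm_apply_apply]⟩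
    · rw [hx] at h2
      simp [block] at h2
  exact (Finset.card_le_card this).trans Finset.card_image_le

/-- The first `t` queries reach both blocks of some pair. -/
def Collides (f : Fin p × Bool → Bool) (A : QueryAlg n) (t : ℕ)
    (σ : Fin n ≃ BlockVertex p k r) : Prop :=
  ∃ u ∈ QueryAlg.askedUpTo (labelledNbrs f σ) A t,
    ∃ v ∈ QueryAlg.askedUpTo (labelledNbrs f σ) A t, Partner (σ u) (σ v)

/-- After `t` queries, the next one asks about a vertex that has not occurred, and completes a pair
of blocks. -/
def FreshCollision (f : Fin p × Bool → Bool) (A : QueryAlg n) (t : ℕ)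
    (σ : Fin n ≃ BlockVertex p k r) : Prop :=
  ∃ v ∈ QueryAlg.asked ((QueryAlg.step (labelledNbrs f σ))^[t] A),
    v ∉ QueryAlg.seenUpTo (labelledNbrs f σ) A t ∧
      ∃ u ∈ QueryAlg.askedUpTo (labelledNbrs f σ) A t, Partner (σ u) (σ v)

/-- At the first collision the vertex asked about is new: had it occurred before, an earlier query
would have asked about it or a neighbor, hence about its block, and the collision would have come
earlier. -/
theorem exists_freshCollision {f : Fin p × Bool → Bool} {A : QueryAlg n} {q : ℕ}
    {σ : Fin n ≃ BlockVertex p k r} (h : Collides f A q σ) : ∃ t < q, FreshCollision f A t σ := by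
  induction q with
  | zero => obtain ⟨u, hu, _⟩ := h; simp [QueryAlg.askedUpTo] at hu
  | succ q ih =>
    by_cases hq : Collides f A q σ
    · obtain ⟨t, ht, h⟩ := ih hq
      exact ⟨t, ht.trans q.lt_succ_self, h⟩
    refine ⟨q, q.lt_succ_self, ?_⟩
    obtain ⟨u, v, hu, hv, huv⟩ : ∃ u v, u ∈ QueryAlg.askedUpTo (labelledNbrs f σ) A q ∧
        v ∈ QueryAlg.asked ((QueryAlg.step (labelledNbrs f σ))^[q] A) ∧
          Partner (σ u) (σ v) := by
      obtain ⟨u, hu, v, hv, huv⟩ := h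
      rw [QueryAlg.askedUpTo_succ, Finset.mem_union] at hu hv
      rcases hu with hu | hu <;> rcases hv with hv | hv
      · obtain rfl := Finset.card_le_one.1 (QueryAlg.card_asked_le _) u hu v hv
        exact absurd huv (Partner.irrefl _)
      · exact ⟨v, u, hv, hu, huv.symm⟩
      · exact ⟨u, v, hu, hv, huv⟩
      · exact absurd ⟨u, hu, v, hv, huv⟩ hq
    refine ⟨v, hv, fun hseen => hq ?_, u, hu, huv⟩
    obtain ⟨w, hw, rfl | hvw⟩ := QueryAlg.exists_of_mem_seenUpTo hseen
    · exact ⟨u, hu, v, hw, huv⟩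
    · exact ⟨u, hu, w, hw, huv.congr_right (block_eq_of_mem_labelledNbrs hvw)⟩

open Finset Classical in
/-- Few labellings lead to a fresh collision after `t` queries. -/
theorem card_freshCollision_le (f : Fin p × Bool → Bool) (A : QueryAlg n) (t : ℕ) :
    #{σ : Fin n ≃ BlockVertex p k r | FreshCollision f A t σ} * (n - 2 * t) ≤
      Fintype.card (Fin n ≃ BlockVertex p k r) * (t * 2 ^ k) := by
  let S : (Fin n ≃ BlockVertex p k r) → Finset (Fin n) := fun σ =>
    univ \ QueryAlg.seenUpTo (labelledNbrs f σ) A t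
  let T : (Fin n ≃ BlockVertex p k r) → Finset (Fin n) := fun σ =>
    (QueryAlg.askedUpTo (labelledNbrs f σ) A t).biUnion fun u => {w | Partner (σ u) (σ w)}
  calc #{σ : Fin n ≃ BlockVertex p k r | FreshCollision f A t σ} * (n - 2 * t)
      ≤ (({σ : Fin n ≃ BlockVertex p k r | FreshCollision f A t σ} : Finset _).sigma S).card := by
        rw [Finset.card_sigma, ← smul_eq_mul]
        refine Finset.card_nsmul_le_sum _ _ _ fun σ _ => ?_
        have := QueryAlg.card_seenUpTo_le (labelledNbrs f σ) A t
        rw [Finset.card_sdiff_of_subset (Finset.subset_univ _), Finset.card_univ,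
          Fintype.card_fin]
        omega
    _ ≤ (univ.sigma T).card := by
        -- `φ` picks the colliding vertex; the default `x.2` is never used on the relevant pairs.
        -- Exchanging the names of this vertex and an unseen `w` leaves the first `t` steps
        -- unchanged and makes `w` a partner of a vertex already asked about.
        let φ : (Σ _ : Fin n ≃ BlockVertex p k r, Fin n) → Fin n := fun x =>
          if h : FreshCollision f A t x.1 then h.choose else x.2
        have hφ : ∀ x ∈ ({σ : Fin n ≃ BlockVertex p k r | FreshCollision f A t σ} :
            Finset _).sigma S,
            φ x ∈ QueryAlg.asked ((QueryAlg.step (labelledNbrs f x.1))^[t] A) ∧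
            φ x ∉ QueryAlg.seenUpTo (labelledNbrs f x.1) A t ∧
            (∃ u ∈ QueryAlg.askedUpTo (labelledNbrs f x.1) A t,
              Partner (x.1 u) (x.1 (φ x))) ∧
            x.2 ∉ QueryAlg.seenUpTo (labelledNbrs f x.1) A t := by
          intro x hx
          simp only [Finset.mem_sigma, Finset.mem_filter, Finset.mem_univ, true_and, S,
            Finset.mem_sdiff] at hx
          simp only [φ, dif_pos hx.1]
          exact ⟨hx.1.choose_spec.1, hx.1.choose_spec.2.1, hx.1.choose_spec.2.2, hx.2⟩
        refine Finset.card_le_card_of_injOn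
          (fun x => ⟨(Equiv.swap (φ x) x.2).trans x.1, x.2⟩) ?_ ?_
        · intro x hx
          obtain ⟨h1, h2, ⟨u, hu, huv⟩, h3⟩ := hφ x hx
          obtain ⟨-, h5, -⟩ := QueryAlg.iterate_step_swap
            (labelledNbrs_swap f x.1 (φ x) x.2) h2 h3
          simp only [Finset.coe_sigma, Set.mem_sigma_iff, Finset.coe_univ, Set.mem_univ, true_and,
            Finset.mem_coe, T, Finset.mem_biUnion, Finset.mem_filter, Finset.mem_univ]
          refine ⟨u, h5 ▸ hu, ?_⟩
          have hu' := QueryAlg.askedUpTo_subset_seenUpTo _ _ _ hu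
          rw [Equiv.trans_apply, Equiv.trans_apply, Equiv.swap_apply_right,
            Equiv.swap_apply_of_ne_of_ne]
          · exact huv
          · rintro rfl; exact h2 hu'
          · rintro rfl; exact h3 hu'
        · intro x hx y hy hxy
          obtain ⟨h1, h2, -, h3⟩ := hφ x hx
          obtain ⟨h1', h2', -, h3'⟩ := hφ y hy
          obtain ⟨h4, -⟩ := QueryAlg.iterate_step_swap (labelledNbrs_swap f x.1 (φ x) x.2) h2 h3
          obtain ⟨h4', -⟩ :=
            QueryAlg.iterate_step_swap (labelledNbrs_swap f y.1 (φ y) y.2) h2' h3'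
          simp only [Sigma.mk.injEq, heq_eq_eq] at hxy
          obtain ⟨hσ, hw⟩ := hxy
          rw [hσ, h4'] at h4
          -- Injectivity: the new labelling determines the run, whose next query asks about the
          -- exchanged vertex, so the exchange can be undone.
          have hv : φ x = φ y := by
            rw [← h4] at h1
            exact Finset.card_le_one.1 (QueryAlg.card_asked_le _) _ h1 _ h1'
          rw [hv, hw] at hσ
          refine Sigma.ext ?_ (heq_of_eq hw)
          ext z
          have := congrArg (fun e => e (Equiv.swap (φ y) y.2 z)) hσ
          simpa using this
    _ ≤ Fintype.card (Fin n ≃ BlockVertex p k r) * (t * 2 ^ k) := by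
        rw [Finset.card_sigma, ← smul_eq_mul, ← Finset.card_univ]
        refine Finset.sum_le_card_nsmul _ _ _ fun σ _ => ?_
        refine (Finset.card_biUnion_le_card_mul _ _ (2 ^ k) fun u _ =>
          card_filter_partner_le σ (σ u)).trans ?_
        exact Nat.mul_le_mul_right _ (QueryAlg.card_askedUpTo_le _ _ _)

open Finset Classical in
theorem card_collides_le (f : Fin p × Bool → Bool) (A : QueryAlg n) (q : ℕ) :
    #{σ : Fin n ≃ BlockVertex p k r | Collides f A q σ} * (n - 2 * q) ≤
      Fintype.card (Fin n ≃ BlockVertex p k r) * (q ^ 2 * 2 ^ k) := by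
  have hsub : ({σ : Fin n ≃ BlockVertex p k r | Collides f A q σ} : Finset _) ⊆
      (Finset.range q).biUnion fun t => {σ | FreshCollision f A t σ} := by
    intro σ hσ
    obtain ⟨t, ht, h⟩ := exists_freshCollision (Finset.mem_filter.1 hσ).2
    simp only [Finset.mem_biUnion, Finset.mem_range, Finset.mem_filter, Finset.mem_univ, true_and]
    exact ⟨t, ht, h⟩
  calc _ ≤ (∑ t ∈ range q, #{σ : Fin n ≃ BlockVertex p k r | FreshCollision f A t σ}) *
        (n - 2 * q) :=
        Nat.mul_le_mul_right _ ((Finset.card_le_card hsub).trans Finset.card_biUnion_le)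
    _ ≤ ∑ t ∈ range q, Fintype.card (Fin n ≃ BlockVertex p k r) * (q * 2 ^ k) := by
        rw [Finset.sum_mul]
        refine Finset.sum_le_sum fun t ht => ?_
        have ht := (Finset.mem_range.1 ht).le
        refine (Nat.mul_le_mul_left _ (by omega)).trans
          ((card_freshCollision_le f A t).trans ?_)
        gcongr
    _ = _ := by
        rw [Finset.sum_const, Finset.card_range, smul_eq_mul]
        ring

end Labelled

/-! ### Coupling mixed with pure fillings. -/

section Coupling

variable {n p k r : ℕ}

open Classical in
/-- The bits for a pure filling that looks like the mixed filling given by `b`: those of the pairs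
whose second block is reached by the first `q` queries are flipped. -/
noncomputable def coupledBits (A : QueryAlg n) (q : ℕ) (σ : Fin n ≃ BlockVertex p k r)
    (b : Fin p → Bool) (j : Fin p) : Bool :=
  b j ^^ decide (∃ v ∈ QueryAlg.askedUpTo (labelledNbrs (mixedFilling b) σ) A q,
    block (σ v) = some (j, true))

/-- In pair `j` the mixed filling puts `b j` in the first block and its negation in the second.
Without a collision at most one of them is reached, and the single pure bit can be chosen to match
it. -/
theorem labelledNbrs_coupledBits {A : QueryAlg n} {q : ℕ} {σ : Fin n ≃ BlockVertex p k r}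
    {b : Fin p → Bool} (h : ¬ Collides (mixedFilling b) A q σ) :
    ∀ v ∈ QueryAlg.askedUpTo (labelledNbrs (mixedFilling b) σ) A q,
      labelledNbrs (pureFilling (coupledBits A q σ b)) σ v =
        labelledNbrs (mixedFilling b) σ v := by
  intro v hv
  refine labelledNbrs_congr ?_
  rintro ⟨j, s⟩ hB
  cases s with
  | true =>
    simp only [pureFilling, coupledBits, mixedFilling]
    rw [decide_eq_true ⟨v, hv, hB⟩, Bool.xor_comm]
  | false =>
    simp only [pureFilling, coupledBits, mixedFilling]
    rw [decide_eq_false, Bool.xor_comm]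
    rintro ⟨u, hu, hB'⟩
    exact h ⟨v, hv, u, hu, j, false, hB, hB'⟩

open Finset Classical in
/-- An algorithm that reaches no two blocks of one pair accepts at least as many pure fillings as
mixed fillings. -/
theorem card_accepts_and_not_collides_le {A : QueryAlg n} {q : ℕ}
    (hA : ∀ G : SimpleGraph (Fin n), G.IsAcyclic → ∀ L : AdjList G, A.numQueries L ≤ q)
    (σ : Fin n ≃ BlockVertex p k r) :
    #{b | A.run (labelledAdjList (mixedFilling b) σ) = true ∧
      ¬ Collides (mixedFilling b) A q σ} ≤
    #{b | A.run (labelledAdjList (pureFilling b) σ) = true} := by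
  refine Finset.card_le_card_of_injOn (coupledBits A q σ) ?_ ?_
  · intro b hb
    simp only [Finset.coe_filter, Finset.mem_univ, true_and, Set.mem_ofPred_eq] at hb ⊢
    have h1 := (QueryAlg.iterate_step_congr (labelledNbrs_coupledBits hb.2)).1
    have h2 := QueryAlg.exists_iterate_step_eq_output
      (hA _ (labelledForest_isAcyclic (mixedFilling b) σ) (labelledAdjList (mixedFilling b) σ))
    have h3 := QueryAlg.exists_iterate_step_eq_output
      (hA _ (labelledForest_isAcyclic _ σ)
        (labelledAdjList (pureFilling (coupledBits A q σ b)) σ))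
    have h4 := (h3.symm.trans h1).trans h2
    rw [QueryAlg.output.injEq] at h4
    exact h4.trans hb.1
  -- The pure filling has the same run, so the coupled bits determine which blocks were reached,
  -- hence which bits were flipped.
  · intro b hb b' hb' h
    simp only [Finset.coe_filter, Finset.mem_univ, true_and, Set.mem_ofPred_eq] at hb hb'
    have h1 := (QueryAlg.iterate_step_congr (labelledNbrs_coupledBits hb.2)).2
    have h2 := (QueryAlg.iterate_step_congr (labelledNbrs_coupledBits hb'.2)).2
    rw [h, h2] at h1
    funext j
    have hj := congrFun h j
    simp only [coupledBits, h1] at hj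
    simpa using hj

open Finset Classical in
theorem card_accepts_le {A : QueryAlg n} {q : ℕ}
    (hA : ∀ G : SimpleGraph (Fin n), G.IsAcyclic → ∀ L : AdjList G, A.numQueries L ≤ q)
    (hn : 2 * p * 2 ^ k ≤ n) (hq : 4 * q ≤ n) :
    p * #{x : (Fin n ≃ BlockVertex p k r) × (Fin p → Bool) |
      A.run (labelledAdjList (mixedFilling x.2) x.1) = true} ≤
    p * #{x : (Fin n ≃ BlockVertex p k r) × (Fin p → Bool) |
      A.run (labelledAdjList (pureFilling x.2) x.1) = true} +
    q ^ 2 * Fintype.card ((Fin n ≃ BlockVertex p k r) × (Fin p → Bool)) := by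
  have hcoll : ∀ b : Fin p → Bool,
      p * #{σ : Fin n ≃ BlockVertex p k r | Collides (mixedFilling b) A q σ} ≤
        Fintype.card (Fin n ≃ BlockVertex p k r) * q ^ 2 := by
    intro b
    have h := card_collides_le (k := k) (r := r) (mixedFilling b) A q
    generalize #{σ : Fin n ≃ BlockVertex p k r | Collides (mixedFilling b) A q σ} = c at h ⊢
    -- At most half of the vertices have been seen, and `2 * p * 2 ^ k ≤ n`; cancelling `2 ^ k`
    -- leaves the ratio `q ^ 2 / p`.
    have h1 : p * 2 ^ k ≤ n - 2 * q := by
      have : 2 * p * 2 ^ k = 2 * (p * 2 ^ k) := mul_assoc _ _ _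
      omega
    refine Nat.le_of_mul_le_mul_right (c := 2 ^ k) ?_ (by positivity)
    calc p * c * 2 ^ k = c * (p * 2 ^ k) := by ring
      _ ≤ c * (n - 2 * q) := Nat.mul_le_mul_left _ h1
      _ ≤ _ := h
      _ = _ := by ring
  have hcount : ∀ R : (Fin n ≃ BlockVertex p k r) → (Fin p → Bool) → Prop, ∀ [∀ σ b, Decidable (R σ b)],
      #{x : (Fin n ≃ BlockVertex p k r) × (Fin p → Bool) | R x.1 x.2} =
        ∑ σ, #{b | R σ b} := by
    intro R _
    simp only [Finset.card_filter]
    exact Fintype.sum_prod_type _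
  have hsplit : #{x : (Fin n ≃ BlockVertex p k r) × (Fin p → Bool) |
      A.run (labelledAdjList (mixedFilling x.2) x.1) = true} ≤
      #{x : (Fin n ≃ BlockVertex p k r) × (Fin p → Bool) |
        A.run (labelledAdjList (mixedFilling x.2) x.1) = true ∧
          ¬ Collides (mixedFilling x.2) A q x.1} +
      #{x : (Fin n ≃ BlockVertex p k r) × (Fin p → Bool) |
          Collides (mixedFilling x.2) A q x.1} := by
    refine (Finset.card_le_card fun x hx => ?_).trans (Finset.card_union_le _ _)
    simp only [Finset.mem_union, Finset.mem_filter, Finset.mem_univ, true_and] at hx ⊢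
    tauto
  have hgood : #{x : (Fin n ≃ BlockVertex p k r) × (Fin p → Bool) |
        A.run (labelledAdjList (mixedFilling x.2) x.1) = true ∧
          ¬ Collides (mixedFilling x.2) A q x.1} ≤
      #{x : (Fin n ≃ BlockVertex p k r) × (Fin p → Bool) |
        A.run (labelledAdjList (pureFilling x.2) x.1) = true} := by
    rw [hcount fun σ b => A.run (labelledAdjList (mixedFilling b) σ) = true ∧
        ¬ Collides (mixedFilling b) A q σ,
      hcount fun σ b => A.run (labelledAdjList (pureFilling b) σ) = true]
    exact Finset.sum_le_sum fun σ _ => card_accepts_and_not_collides_le hA σ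
  have hbad : p * #{x : (Fin n ≃ BlockVertex p k r) × (Fin p → Bool) |
          Collides (mixedFilling x.2) A q x.1} ≤
      q ^ 2 * Fintype.card ((Fin n ≃ BlockVertex p k r) × (Fin p → Bool)) := by
    rw [Finset.card_filter, Fintype.sum_prod_type_right, Finset.mul_sum, Fintype.card_prod,
      mul_comm (Fintype.card _), mul_comm, ← Finset.card_univ (α := Fin p → Bool), mul_assoc,
      ← smul_eq_mul (Finset.card _)]
    refine Finset.sum_le_card_nsmul _ _ _ fun b _ => ?_
    rw [← Finset.card_filter]
    exact hcoll b
  calc _ ≤ _ := Nat.mul_le_mul_left p (hsplit.trans (Nat.add_le_add_right hgood _))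
    _ ≤ _ := by rw [mul_add]; exact Nat.add_le_add_left hbad _

end Coupling

/-! ### From deterministic algorithms to randomized testers. -/

section Tester

open MeasureTheory

-- Linearity of expectation: the counting inequality for each deterministic algorithm is integrated
-- over the random choices.
open Finset Classical in
theorem sum_measureReal_le_of_card_le {Ω ι : Type*} [MeasurableSpace Ω] (P : Measure Ω)
    [IsProbabilityMeasure P] [Fintype ι] {S T : ι → Set Ω} (hS : ∀ i, MeasurableSet (S i))
    (hT : ∀ i, MeasurableSet (T i)) {a c : ℝ}
    (h : ∀ ω, a * #{i | ω ∈ S i} ≤ a * #{i | ω ∈ T i} + c) :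
    a * ∑ i, P.real (S i) ≤ a * ∑ i, P.real (T i) + c := by
  have hint : ∀ {S : ι → Set Ω}, (∀ i, MeasurableSet (S i)) →
      Integrable (fun ω => (#{i | ω ∈ S i} : ℝ)) P ∧
        ∫ ω, (#{i | ω ∈ S i} : ℝ) ∂P = ∑ i, P.real (S i) := by
    intro S hS
    have h1 : (fun ω => (#{i | ω ∈ S i} : ℝ)) =
        fun ω => ∑ i, (S i).indicator (1 : Ω → ℝ) ω := by
      funext ω
      simp [Set.indicator_apply]
    have h2 : ∀ i, Integrable ((S i).indicator (1 : Ω → ℝ)) P := fun i =>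
      (integrable_const (1 : ℝ)).indicator (hS i)
    rw [h1]
    refine ⟨integrable_finsetSum _ fun i _ => h2 i, ?_⟩
    rw [integral_finsetSum _ fun i _ => h2 i]
    exact Finset.sum_congr rfl fun i _ => integral_indicator_one (hS i)
  obtain ⟨h1, h2⟩ := hint hS
  obtain ⟨h3, h4⟩ := hint hT
  have := integral_mono (h1.const_mul a) ((h3.const_mul a).add (integrable_const c)) h
  simp only [Pi.add_apply] at this
  rw [integral_add (h3.const_mul a) (integrable_const c), integral_const_mul, integral_const_mul,
    h2, h4] at this
  simpa using this

/-- A tester for the forest with a mixed filling makes at least `√(p / 3)` queries. -/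
theorem le_three_mul_sq_of_isForestIsoTester {n p k r : ℕ} (hk : 2 * p + 1 ≤ k)
    (hn : 2 * p * 2 ^ k ≤ n) (hn' : n ≤ 4 * p * 2 ^ k) (σ₀ : Fin n ≃ BlockVertex p k r)
    (b₀ : Fin p → Bool) {ε : ℝ} (hε : ε ≤ 1 / 16) {Ω : Type*} [MeasurableSpace Ω] {P : Measure Ω}
    [IsProbabilityMeasure P] {A : Ω → QueryAlg n} {q : ℕ}
    (hA : IsForestIsoTester P A ε (labelledForest (mixedFilling b₀) σ₀))
    (hq : MakesAtMostQueries A q) : p ≤ 3 * q ^ 2 := by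
  classical
  by_cases hqn : 4 * q ≤ n
  swap
  -- With this many queries the claim is trivial: `2 * p ≤ n < 4 * q ≤ 4 * q ^ 2`.
  · have h1 : p * 1 ≤ p * 2 ^ k := Nat.mul_le_mul_left p Nat.one_le_two_pow
    have h2 : 2 * p * 2 ^ k = 2 * (p * 2 ^ k) := mul_assoc _ _ _
    have h3 : q ≤ q ^ 2 := Nat.le_self_pow two_ne_zero q
    omega
  have hfar : ∀ (σ : Fin n ≃ BlockVertex p k r) b,
      IsFarFromIso ε (labelledForest (pureFilling b) σ) (labelledForest (mixedFilling b₀) σ₀) := by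
    intro σ b
    have h1 : n ≤ 16 * graphDist (labelledForest (pureFilling b) σ)
        (labelledForest (mixedFilling b₀) σ₀) := by
      have : p * 2 ^ k ≤ 4 * graphDist (labelledForest (pureFilling b) σ)
          (labelledForest (mixedFilling b₀) σ₀) := mul_two_pow_le_graphDist hk σ σ₀ b b₀
      have h2 : 4 * p * 2 ^ k = 4 * (p * 2 ^ k) := mul_assoc _ _ _
      omega
    have h2 : (n : ℝ) ≤ 16 * (graphDist (labelledForest (pureFilling b) σ)
        (labelledForest (mixedFilling b₀) σ₀) : ℝ) := by exact_mod_cast h1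
    have h3 : ε * n ≤ 1 / 16 * n := by gcongr
    unfold IsFarFromIso
    linarith
  have hiso : ∀ (σ : Fin n ≃ BlockVertex p k r) b, Nonempty
      (labelledForest (mixedFilling b) σ ≃g labelledForest (mixedFilling b₀) σ₀) := by
    intro σ b
    obtain ⟨e⟩ := nonempty_iso_mixedFilling (k := k) (r := r) b b₀
    exact ⟨(SimpleGraph.Iso.comap σ _).trans (e.trans (SimpleGraph.Iso.comap σ₀ _).symm)⟩
  set ι := (Fin n ≃ BlockVertex p k r) × (Fin p → Bool)
  have hι : (0 : ℝ) < Fintype.card ι := by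
    exact_mod_cast Fintype.card_pos_iff.2 ⟨(σ₀, b₀)⟩
  have hmeas : ∀ (f : Fin p × Bool → Bool) (σ : Fin n ≃ BlockVertex p k r),
      MeasurableSet {ω | (A ω).run (labelledAdjList f σ) = true} := fun f σ =>
    hA.measurable_accept _ (labelledForest_isAcyclic f σ) _
  have key := sum_measureReal_le_of_card_le P
    (S := fun x : ι => {ω | (A ω).run (labelledAdjList (mixedFilling x.2) x.1) = true})
    (T := fun x : ι => {ω | (A ω).run (labelledAdjList (pureFilling x.2) x.1) = true})
    (fun x => hmeas _ _) (fun x => hmeas _ _) (a := p) (c := q ^ 2 * Fintype.card ι)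
    (fun ω => by
      have := card_accepts_le (r := r) (fun G hG L => hq G hG L ω) hn hqn
      simp only [Set.mem_ofPred_eq]
      exact_mod_cast this)
  have hS : (Fintype.card ι : ℝ) * (2 / 3) ≤ ∑ x : ι,
      P.real {ω | (A ω).run (labelledAdjList (mixedFilling x.2) x.1) = true} := by
    rw [← nsmul_eq_mul]
    exact Finset.card_nsmul_le_sum _ _ _ fun x _ =>
      hA.accepts _ (labelledForest_isAcyclic _ _) _ (hiso _ _)
  have hT : ∑ x : ι, P.real {ω | (A ω).run (labelledAdjList (pureFilling x.2) x.1) = true} ≤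
      (Fintype.card ι : ℝ) * (1 / 3) := by
    rw [← nsmul_eq_mul]
    refine Finset.sum_le_card_nsmul _ _ _ fun x _ => ?_
    have h1 := hA.rejects _ (labelledForest_isAcyclic _ _)
      (labelledAdjList (pureFilling x.2) x.1) (hfar _ _)
    have h2 : {ω | (A ω).run (labelledAdjList (pureFilling x.2) x.1) = false} =
        {ω | (A ω).run (labelledAdjList (pureFilling x.2) x.1) = true}ᶜ := by
      ext ω
      simp
    rw [h2, probReal_compl_eq_one_sub (hmeas _ _)] at h1
    linarith
  have hp : (0 : ℝ) ≤ p := p.cast_nonneg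
  have h1 := mul_le_mul_of_nonneg_left hS hp
  have h2 := mul_le_mul_of_nonneg_left hT hp
  have h3 : (p : ℝ) * Fintype.card ι ≤ (3 * q ^ 2) * Fintype.card ι := by linarith
  exact_mod_cast le_of_mul_le_mul_right h3 hι

end Tester

/-! ### Choice of the parameters. -/

theorem theorem2 :
    ∃ ε₀ : ℝ, 0 < ε₀ ∧ ∃ c : ℝ, 0 < c ∧ ∃ n₀ : ℕ, ∀ n : ℕ, n₀ ≤ n →
      ∃ H : SimpleGraph (Fin n), H.IsAcyclic ∧
        ∀ ε : ℝ, 0 < ε → ε ≤ ε₀ →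
          ∀ (Ω : Type*) [MeasurableSpace Ω] (P : MeasureTheory.Measure Ω)
            [MeasureTheory.IsProbabilityMeasure P] (A : Ω → QueryAlg n) (q : ℕ),
            IsForestIsoTester P A ε H → MakesAtMostQueries A q →
              c * √(Real.log (n : ℝ)) ≤ (q : ℝ) := by
  -- `1 / 16` combines `p * 2 ^ k ≤ 4 * graphDist` with `n ≤ 4 * p * 2 ^ k`; `256 = 2 ^ 8` makes `p
  -- ≥ 1`; and `7 ^ 2 ≥ 48` for the bound `log n ≤ 48 * q ^ 2` below.
  refine ⟨1 / 16, by norm_num, 1 / 7, by norm_num, 256, fun n hn => ?_⟩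
  have hn0 : n ≠ 0 := by omega
  have hlog8 : 8 ≤ Nat.log 2 n := Nat.le_log_of_pow_le one_lt_two hn
  obtain ⟨p, hp⟩ : ∃ p, p = Nat.log 2 n / 8 := ⟨_, rfl⟩
  have hp1 : 1 ≤ p := by omega
  have hpn : 2 * p * 2 ^ (2 * p + 1) ≤ n := by
    have h1 : 2 * p ≤ 2 ^ (2 * p) := Nat.lt_two_pow_self.le
    calc 2 * p * 2 ^ (2 * p + 1) ≤ 2 ^ (2 * p) * 2 ^ (2 * p + 1) := Nat.mul_le_mul_right _ h1
      _ = 2 ^ (4 * p + 1) := by rw [← pow_add]; congr 1; ring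
      _ ≤ 2 ^ Nat.log 2 n := Nat.pow_le_pow_right two_pos (by omega)
      _ ≤ n := Nat.pow_log_le_self 2 hn0
  have hdiv : 2 ^ (2 * p + 1) ≤ n / (2 * p) := by
    rw [Nat.le_div_iff_mul_le (by omega), mul_comm]
    exact hpn
  -- The largest `k` for which the blocks fit: they fill at least half of the vertices, and the rest
  -- are isolated.
  obtain ⟨k, hk⟩ : ∃ k, k = Nat.log 2 (n / (2 * p)) := ⟨_, rfl⟩
  have hk1 : 2 * p + 1 ≤ k := hk ▸ Nat.le_log_of_pow_le one_lt_two hdiv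
  have hdiv0 : n / (2 * p) ≠ 0 := by
    have := Nat.one_le_two_pow (n := 2 * p + 1)
    omega
  have hlow : 2 * p * 2 ^ k ≤ n := by
    have := Nat.pow_log_le_self 2 hdiv0
    rw [← hk, Nat.le_div_iff_mul_le (by omega), mul_comm] at this
    exact this
  have hupp : n ≤ 4 * p * 2 ^ k := by
    have := Nat.lt_pow_succ_log_self one_lt_two (n / (2 * p))
    rw [← hk, Nat.div_lt_iff_lt_mul (by omega), pow_succ] at this
    calc n ≤ 2 ^ k * 2 * (2 * p) := this.le
      _ = _ := by ring
  have hcard : Fintype.card (Fin n) =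
      Fintype.card (BlockVertex p k (n - 2 * p * 2 ^ k)) := by
    simp only [Fintype.card_fin, Fintype.card_sum, Fintype.card_prod, Fintype.card_bool]
    rw [mul_comm p 2]
    omega
  let σ : Fin n ≃ BlockVertex p k (n - 2 * p * 2 ^ k) := Fintype.equivOfCardEq hcard
  refine ⟨labelledForest (mixedFilling fun _ => false) σ, labelledForest_isAcyclic _ _, ?_⟩
  intro ε _ hε Ω _ P _ A q hA hq
  have hpq := le_three_mul_sq_of_isForestIsoTester hk1 hlow hupp σ _ hε hA hq
  have hlog : Real.log n ≤ 48 * (q : ℝ) ^ 2 := by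
    have h1 : (n : ℝ) ≤ 2 ^ (Nat.log 2 n + 1) := by
      exact_mod_cast (Nat.lt_pow_succ_log_self one_lt_two n).le
    have h2 : Real.log n ≤ (Nat.log 2 n + 1 : ℕ) * Real.log 2 := by
      rw [← Real.log_pow]
      exact Real.log_le_log (by exact_mod_cast Nat.pos_of_ne_zero hn0) h1
    have h3 : ((Nat.log 2 n + 1 : ℕ) : ℝ) ≤ 48 * (q : ℝ) ^ 2 := by
      -- By the choice of `p`, `Nat.log 2 n + 1 ≤ 8 * p + 8 ≤ 16 * p`, and `p ≤ 3 * q ^ 2`.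
      have : Nat.log 2 n + 1 ≤ 48 * q ^ 2 := by omega
      exact_mod_cast this
    have h4 : Real.log 2 ≤ 1 := by linarith [Real.log_two_lt_d9]
    have h5 : ((Nat.log 2 n + 1 : ℕ) : ℝ) * Real.log 2 ≤ (Nat.log 2 n + 1 : ℕ) * 1 := by
      gcongr
    linarith
  have hsqrt : √(Real.log n) ≤ 7 * q := by
    rw [Real.sqrt_le_left (by positivity)]
    nlinarith [sq_nonneg (q : ℝ)]
  linarith
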